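/- Let $\mathbb{K}$ be $\mathbb{R}$ or $\mathbb{C}$; Hilbert spaces are over $\mathbb{K}$. The product $ST$ of two unbounded operators has the natural domain $D(ST)=\{x\in D(T): Tx\in D(S)\}$. A linear operator $A$ in a Hilbert space $H$ is called positive if it is symmetric ($\langle Ax,y\rangle=\langle x,Ay\rangle$ for $x,y\in D(A)$) and $\langle Ax,x\rangle\ge 0$ for all $x\in D(A)$; it is called essentially self-adjoint if it is closable and its closure is self-adjoint. For a densely defined positive operator $A$ in $H$, the formula $$\langle Ax,Ay\rangle_A=\langle Ax,y\rangle,\qquad x,y\in D(A),$$ defines an inner product on $\operatorname{ran}A$. Let $H_A$ be the completion of this pre-Hilbert space and let $T_A: H_A\supseteq \operatorname{ran}A\to H$ be the canonical embedding, $T_A(Ax)=Ax$ for $x\in D(A)$, with domain $D(T_A)=\operatorname{ran}A$. (1) There are a Hilbert space $H$ and a densely defined positive operator $A$ in $H$ that is not essentially self-adjoint and has dense range in $H$, such that $T=T_A$ is a densely defined closable operator with $(TT^*)^*\neq\overline{T}\,T^*$. (2) For every Hilbert space $H$ and every densely defined positive operator $A$ in $H$ that is not essentially self-adjoint and has dense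 range in $H$, the operator $T=T_A$ has the following properties: - $T$ is densely defined and closable; - $D(A)\subseteq D(T^*)$ and $T^*x=Ax\in H_A$ for all $x\in D(A)$; - $T^{**}=\overline{T}$, and $\overline{T}\,T^*$ is a self-adjoint positive extension of $A$; - $T^*$ is one-to-one; - $TT^*=A$ (in particular $D(TT^*)=D(A)$); - $(TT^*)^*=A^*$ is not self-adjoint; consequently $(TT^*)^*\neq\overline{T}\,T^*$ and $(TT^*)^*\neq TT^*$. -/

import Mathlib

/-! Unbounded operators are `LinearPMap`s `E →ₗ.[𝕜] F`; `T.adjoint`, `T.closure`, `T.IsClosable` and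
`IsSelfAdjoint` are Mathlib's notions for them, and `S ≤ T` means that `T` extends `S`. -/

universe u v

noncomputable section

namespace LinearPMap

section Product

variable {𝕜 E F G : Type*} [Ring 𝕜] [AddCommGroup E] [Module 𝕜 E] [AddCommGroup F] [Module 𝕜 F]
  [AddCommGroup G] [Module 𝕜 G]

/-- The product `S T` of unbounded operators on its natural domain
`D(S T) = {x ∈ D(T) : T x ∈ D(S)}`, with `(S T) x = S (T x)`. -/
def prodOp (S : F →ₗ.[𝕜] G) (T : E →ₗ.[𝕜] F) : E →ₗ.[𝕜] G where
  domain :=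
    { carrier := {x | ∃ hx : x ∈ T.domain, T ⟨x, hx⟩ ∈ S.domain}
      zero_mem' := ⟨T.domain.zero_mem, by
        have h : T ⟨0, T.domain.zero_mem⟩ = 0 := T.map_zero
        rw [h]; exact S.domain.zero_mem⟩
      add_mem' := by
        rintro x y ⟨hx, hx'⟩ ⟨hy, hy'⟩
        refine ⟨T.domain.add_mem hx hy, ?_⟩
        have h : T ⟨x + y, T.domain.add_mem hx hy⟩ = T ⟨x, hx⟩ + T ⟨y, hy⟩ :=
          T.map_add ⟨x, hx⟩ ⟨y, hy⟩
        rw [h]; exact S.domain.add_mem hx' hy'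
      smul_mem' := by
        rintro c x ⟨hx, hx'⟩
        refine ⟨T.domain.smul_mem c hx, ?_⟩
        have h : T ⟨c • x, T.domain.smul_mem c hx⟩ = c • T ⟨x, hx⟩ := T.map_smul c ⟨x, hx⟩
        rw [h]; exact S.domain.smul_mem c hx' }
  toFun :=
    { toFun := fun x => S ⟨T ⟨x.1, x.2.choose⟩, x.2.choose_spec⟩
      map_add' := by
        intro x y
        rw [← S.map_add]
        congr 1
        exact Subtype.ext (T.map_add ⟨x.1, x.2.choose⟩ ⟨y.1, y.2.choose⟩)
      map_smul' := by
        intro c x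
        rw [RingHom.id_apply, ← S.map_smul]
        congr 1
        exact Subtype.ext (T.map_smul c ⟨x.1, x.2.choose⟩) }

theorem mem_prodOp_domain {S : F →ₗ.[𝕜] G} {T : E →ₗ.[𝕜] F} {x : E} :
    x ∈ (S.prodOp T).domain ↔ ∃ hx : x ∈ T.domain, T ⟨x, hx⟩ ∈ S.domain :=
  Iff.rfl

theorem prodOp_apply {S : F →ₗ.[𝕜] G} {T : E →ₗ.[𝕜] F} (x : (S.prodOp T).domain)
    (hx : (x : E) ∈ T.domain) (hx' : T ⟨x, hx⟩ ∈ S.domain) :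
    S.prodOp T x = S ⟨T ⟨x, hx⟩, hx'⟩ :=
  rfl

end Product

variable {𝕜 H : Type*} [RCLike 𝕜] [NormedAddCommGroup H] [InnerProductSpace 𝕜 H]

/-- A positive operator: symmetric, with `⟨A x, x⟩ ≥ 0` on its domain. -/
def IsPositive (A : H →ₗ.[𝕜] H) : Prop :=
  (∀ x y : A.domain, inner 𝕜 (A x) (y : H) = inner 𝕜 (x : H) (A y)) ∧
    ∀ x : A.domain, 0 ≤ RCLike.re (inner 𝕜 (A x) (x : H))

/-- An operator is essentially self-adjoint if its closure is self-adjoint. -/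
def IsEssentiallySelfAdjoint [CompleteSpace H] (A : H →ₗ.[𝕜] H) : Prop :=
  A.IsClosable ∧ IsSelfAdjoint A.closure

/-- The vector space `ran A`, as a type of its own because it does not carry the norm of `H`
but the one of the inner product `⟨A x, A y⟩_A = ⟨A x, y⟩` (see `RanSpace.inner_mk_mk`). -/
def RanSpace (A : H →ₗ.[𝕜] H) (_hd : Dense (A.domain : Set H)) (_hA : A.IsPositive) : Type _ :=
  LinearMap.range A.toFun

namespace RanSpace

variable {A : H →ₗ.[𝕜] H} {hd : Dense (A.domain : Set H)} {hA : A.IsPositive}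

instance : AddCommGroup (RanSpace A hd hA) :=
  inferInstanceAs (AddCommGroup (LinearMap.range A.toFun))

instance : Module 𝕜 (RanSpace A hd hA) :=
  inferInstanceAs (Module 𝕜 (LinearMap.range A.toFun))

variable (A hd hA) in
/-- The inclusion of `ran A` into `H`, as a linear map. -/
def toH : RanSpace A hd hA →ₗ[𝕜] H :=
  (LinearMap.range A.toFun).subtype

variable (A hd hA) in
/-- The vector `A x`, as an element of `ran A`. -/
def mk (x : A.domain) : RanSpace A hd hA :=
  ⟨A x, LinearMap.mem_range_self A.toFun x⟩

@[simp]
theorem toH_mk (x : A.domain) : toH A hd hA (mk A hd hA x) = A x := rfl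

theorem toH_injective : Function.Injective (toH A hd hA) := Subtype.val_injective

theorem mk_surjective : Function.Surjective (mk A hd hA) := by
  rintro ⟨_, x, rfl⟩
  exact ⟨x, rfl⟩

/-- The form `⟨A x, A y⟩_A = ⟨A x, y⟩` on `ran A`. -/
def form (u v : RanSpace A hd hA) : 𝕜 :=
  inner 𝕜 (toH A hd hA u) ((mk_surjective v).choose : H)

theorem form_mk_mk (x y : A.domain) :
    form (mk A hd hA x) (mk A hd hA y) = inner 𝕜 (A x) (y : H) := by
  have h : A (mk_surjective (mk A hd hA y)).choose = A y :=
    congrArg (toH A hd hA) (mk_surjective (mk A hd hA y)).choose_spec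
  change inner 𝕜 (A x) ((mk_surjective (mk A hd hA y)).choose : H) = _
  rw [hA.1, h, ← hA.1]

theorem form_mk (u : RanSpace A hd hA) (y : A.domain) :
    form u (mk A hd hA y) = inner 𝕜 (toH A hd hA u) (y : H) := by
  obtain ⟨x, rfl⟩ := mk_surjective u
  exact form_mk_mk x y

variable (A hd hA) in
@[reducible]
def preCore : PreInnerProductSpace.Core 𝕜 (RanSpace A hd hA) where
  inner := form
  conj_inner_symm u v := by
    obtain ⟨x, rfl⟩ := mk_surjective u
    obtain ⟨y, rfl⟩ := mk_surjective v
    rw [form_mk_mk, form_mk_mk, inner_conj_symm, hA.1]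
  re_inner_nonneg u := by
    obtain ⟨x, rfl⟩ := mk_surjective u
    rw [form_mk_mk]
    exact hA.2 x
  add_left u v w := by
    obtain ⟨z, rfl⟩ := mk_surjective w
    rw [form_mk, form_mk, form_mk, (toH A hd hA).map_add, inner_add_left]
  smul_left u v c := by
    obtain ⟨z, rfl⟩ := mk_surjective v
    rw [form_mk, form_mk, (toH A hd hA).map_smul, inner_smul_left]

variable (A hd hA) in
@[reducible]
def core : InnerProductSpace.Core 𝕜 (RanSpace A hd hA) where
  toCore := preCore A hd hA
  definite u hu := by
    apply toH_injective
    rw [(toH A hd hA).map_zero]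
    refine hd.eq_zero_of_inner_left 𝕜 fun y hy => ?_
    rw [← form_mk u ⟨y, hy⟩]
    set v := mk A hd hA ⟨y, hy⟩
    have hu' : form u u = 0 := hu
    have h : ‖form u v‖ * ‖form v u‖ ≤ RCLike.re (form u u) * RCLike.re (form v v) :=
      @InnerProductSpace.Core.inner_mul_inner_self_le 𝕜 _ _ _ _ (preCore A hd hA) u v
    have hs : ‖form v u‖ = ‖form u v‖ := by
      rw [← RCLike.norm_conj (form v u)]
      exact congrArg norm ((preCore A hd hA).conj_inner_symm u v)
    rw [hs, hu', _root_.map_zero, zero_mul] at h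
    exact norm_eq_zero.1 (mul_self_eq_zero.1 (le_antisymm h (mul_self_nonneg _)))

instance : NormedAddCommGroup (RanSpace A hd hA) :=
  (core A hd hA).toNormedAddCommGroup

instance : InnerProductSpace 𝕜 (RanSpace A hd hA) :=
  InnerProductSpace.ofCore (preCore A hd hA)

/-- The inner product of `ran A`; in particular it does not depend on the chosen preimages. -/
theorem inner_mk_mk (x y : A.domain) :
    inner 𝕜 (mk A hd hA x) (mk A hd hA y) = inner 𝕜 (A x) (y : H) :=
  form_mk_mk x y

end RanSpace

variable (A : H →ₗ.[𝕜] H) (hd : Dense (A.domain : Set H)) (hA : A.IsPositive)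

/-- The Hilbert space `H_A`: the completion of `ran A` for `⟨A x, A y⟩_A = ⟨A x, y⟩`. -/
abbrev EnergySpace : Type _ := UniformSpace.Completion (RanSpace A hd hA)

/-- The isometric linear inclusion of `ran A` into its completion `H_A`. -/
def toEnergySpace : RanSpace A hd hA →ₗᵢ[𝕜] EnergySpace A hd hA :=
  UniformSpace.Completion.toComplₗᵢ

/-- The canonical embedding `T : H_A ⊇ ran A → H`, `T (A x) = A x`. -/
def ranEmbedding : EnergySpace A hd hA →ₗ.[𝕜] H where
  domain := LinearMap.range (toEnergySpace A hd hA).toLinearMap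
  toFun := (RanSpace.toH A hd hA).comp
    (LinearEquiv.ofInjective (toEnergySpace A hd hA).toLinearMap
      (toEnergySpace A hd hA).injective).symm.toLinearMap

theorem mem_ranEmbedding_domain (u : RanSpace A hd hA) :
    toEnergySpace A hd hA u ∈ (ranEmbedding A hd hA).domain :=
  ⟨u, rfl⟩

theorem ranEmbedding_apply (u : RanSpace A hd hA) :
    ranEmbedding A hd hA ⟨toEnergySpace A hd hA u, mem_ranEmbedding_domain A hd hA u⟩ =
      RanSpace.toH A hd hA u :=
  congrArg (RanSpace.toH A hd hA)
    (LinearEquiv.ofInjective_symm_apply (h := (toEnergySpace A hd hA).injective)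
      (f := (toEnergySpace A hd hA).toLinearMap)
      ⟨toEnergySpace A hd hA u, mem_ranEmbedding_domain A hd hA u⟩ |> fun h =>
      (toEnergySpace A hd hA).injective h)

end LinearPMap

end

/-! Since `⟨Ax, Ay⟩_A = ⟨x, Ay⟩`, the vector `Ax` of `H_A` represents `u ↦ ⟨x, Tu⟩`, so `T*` extends
`x ↦ Ax` and is densely defined. Hence `T** = T̄`, and `T̄T* = S*S` for the closed operator `S = T*`
is self-adjoint by von Neumann's theorem. Dense range makes `T*` injective, which forces `TT* = A`:
if `T*x = Ay = T*y`, then `x = y`. So `(TT*)* = A*`, and were this self-adjoint, `Ā = A** = A*`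
would be too.

For existence, take a diagonal `0 < R < 1` on `ℓ²` and restrict `R⁻¹ - 1` to `R(v^⊥)`, where `v`
lies in neither `ran R` nor `ran (1 - R)`. The vector `v` is then orthogonal to `ran (1 + A)`. -/

namespace LinearPMap

/-! ### Double adjoints and the operator `S*S`. -/

section DoubleAdjoint

variable {𝕜 E F : Type*} [RCLike 𝕜] [NormedAddCommGroup E] [InnerProductSpace 𝕜 E]
  [NormedAddCommGroup F] [InnerProductSpace 𝕜 F] [CompleteSpace E] [CompleteSpace F]
  {T : E →ₗ.[𝕜] F}

theorem le_adjoint_adjoint (hT : Dense (T.domain : Set E))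
    (hT' : Dense (T.adjoint.domain : Set F)) : T ≤ T.adjoint.adjoint :=
  (adjoint_isFormalAdjoint hT).le_adjoint hT'

theorem isClosable_of_dense_adjoint_domain (hT : Dense (T.domain : Set E))
    (hT' : Dense (T.adjoint.domain : Set F)) : T.IsClosable :=
  isClosable_iff_exists_closed_extension.2
    ⟨_, adjoint_isClosed hT', le_adjoint_adjoint hT hT'⟩

/-- The adjoint is the orthogonal complement turned by `(a, b) ↦ (b, -a)`, so the double adjoint
lies in `gᗮᗮ`, the closure. `WithLp 2` supplies the inner product on `E × F` without changing the
topology. -/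
theorem _root_.Submodule.adjoint_adjoint_le_topologicalClosure (g : Submodule 𝕜 (E × F)) :
    g.adjoint.adjoint ≤ g.topologicalClosure := by
  intro p hp
  let e := WithLp.prodContinuousLinearEquiv 2 𝕜 E F
  let K : Submodule 𝕜 (WithLp 2 (E × F)) := g.comap e.toLinearMap
  have hp' : WithLp.toLp 2 p ∈ Kᗮᗮ := by
    rw [Submodule.mem_orthogonal]
    intro u hu
    have hmem : (u.snd, -u.fst) ∈ g.adjoint := by
      rw [Submodule.mem_adjoint_iff]
      intro a b hab
      have h : inner 𝕜 (WithLp.toLp 2 (a, b)) u = 0 :=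
        (Submodule.mem_orthogonal _ _).1 hu _ hab
      rw [WithLp.prod_inner_apply] at h
      simpa [add_comm] using h
    have h := (Submodule.mem_adjoint_iff _ _).1 hp _ _ hmem
    rw [WithLp.prod_inner_apply]
    simp only [inner_neg_left] at h
    rw [← neg_eq_zero, ← h]
    change -(inner 𝕜 u.fst p.1 + inner 𝕜 u.snd p.2) = _
    ring
  rw [Submodule.orthogonal_orthogonal_eq_closure] at hp'
  have hp'' : WithLp.toLp 2 p ∈ _root_.closure (e ⁻¹' (g : Set (E × F))) := hp'
  rw [← SetLike.mem_coe, Submodule.topologicalClosure_coe]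
  exact (e.toHomeomorph.preimage_closure (g : Set (E × F))).symm.subset hp''

theorem adjoint_adjoint_eq_closure (hT : Dense (T.domain : Set E))
    (hT' : Dense (T.adjoint.domain : Set F)) : T.adjoint.adjoint = T.closure := by
  have hc := isClosable_of_dense_adjoint_domain hT hT'
  apply le_antisymm
  · rw [← le_graph_iff, adjoint_graph_eq_graph_adjoint hT', adjoint_graph_eq_graph_adjoint hT,
      ← hc.graph_closure_eq_closure_graph]
    exact Submodule.adjoint_adjoint_le_topologicalClosure _
  · rw [← le_graph_iff, ← hc.graph_closure_eq_closure_graph]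
    exact Submodule.topologicalClosure_minimal _ (le_graph_of_le (le_adjoint_adjoint hT hT'))
      (adjoint_isClosed hT')

/-- The key step of von Neumann's theorem: `1 + S* S` is onto for closed `S`. -/
theorem IsClosed.exists_add_prodOp_adjoint_eq {S : F →ₗ.[𝕜] E} (hS : S.IsClosed)
    (hd : Dense (S.domain : Set F)) (x : F) :
    ∃ a : (S.adjoint.prodOp S).domain, (a : F) + S.adjoint.prodOp S a = x := by
  let e := WithLp.prodContinuousLinearEquiv 2 𝕜 F E
  let K : Submodule 𝕜 (WithLp 2 (F × E)) := S.graph.comap e.toLinearMap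
  have hK : _root_.IsClosed (K : Set (WithLp 2 (F × E))) := hS.preimage e.continuous
  have : CompleteSpace K := hK.completeSpace_coe
  -- Split `(x, 0) = (a, Sa) + (x - a, -Sa)` along the graph of `S`; orthogonality of the second
  -- term to the graph says `S*Sa = x - a`.
  obtain ⟨p, hp, q, hq, hpq⟩ := K.exists_add_mem_mem_orthogonal (WithLp.toLp 2 (x, 0))
  have h1 : x = p.fst + q.fst := congrArg WithLp.fst hpq
  have h2 : 0 = p.snd + q.snd := congrArg WithLp.snd hpq
  have hp' : (p.fst, p.snd) ∈ S.graph := hp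
  obtain ⟨a, ha, ha'⟩ := (mem_graph_iff S).1 hp'
  dsimp only at ha ha'
  have key (z : S.domain) : inner 𝕜 q.fst (z : F) = inner 𝕜 (S a) (S z) := by
    have h : inner 𝕜 q (WithLp.toLp 2 ((z : F), S z)) = 0 :=
      (Submodule.mem_orthogonal' _ _).1 hq _ (S.mem_graph z)
    rw [WithLp.prod_inner_apply] at h
    rw [ha', eq_neg_of_add_eq_zero_left h2.symm, inner_neg_left]
    exact eq_neg_of_add_eq_zero_left h
  have hmem : S a ∈ S.adjoint.domain := mem_adjoint_domain_of_exists _ ⟨_, key⟩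
  refine ⟨⟨a, a.2, hmem⟩, ?_⟩
  rw [prodOp_apply _ a.2 hmem, adjoint_apply_eq hd _ key, h1, ha]

omit [CompleteSpace E] in
theorem isPositive_adjoint_prodOp {S : F →ₗ.[𝕜] E} (hd : Dense (S.domain : Set F)) :
    (S.adjoint.prodOp S).IsPositive := by
  have key (x : (S.adjoint.prodOp S).domain) (y : S.domain) :
      inner 𝕜 (S.adjoint.prodOp S x) (y : F) = inner 𝕜 (S ⟨x, x.2.1⟩) (S y) :=
    adjoint_isFormalAdjoint hd _ _
  refine ⟨fun x y => ?_, fun x => ?_⟩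
  · rw [key x ⟨y, y.2.1⟩, ← inner_conj_symm (x : F), key y ⟨x, x.2.1⟩, inner_conj_symm]
  · rw [key x ⟨x, x.2.1⟩]
    exact inner_self_nonneg

end DoubleAdjoint

/-! ### Self-adjointness of positive operators. -/

section Positive

variable {𝕜 H : Type*} [RCLike 𝕜] [NormedAddCommGroup H] [InnerProductSpace 𝕜 H]
  [CompleteSpace H] {A : H →ₗ.[𝕜] H}

theorem IsPositive.le_adjoint (hA : A.IsPositive) (hd : Dense (A.domain : Set H)) :
    A ≤ A.adjoint :=
  IsFormalAdjoint.le_adjoint hd hA.1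

theorem IsPositive.dense_adjoint_domain (hA : A.IsPositive) (hd : Dense (A.domain : Set H)) :
    Dense (A.adjoint.domain : Set H) :=
  hd.mono (hA.le_adjoint hd).1

/-- For `x ∈ D(A*)` solve `a + Aa = x + A*x`. Then `x - a` is in the kernel of `1 + A*`, hence
orthogonal to `ran (1 + A) = H`, so `x = a ∈ D(A)`. -/
theorem IsPositive.isSelfAdjoint_of_one_add_surjective (hA : A.IsPositive)
    (hd : Dense (A.domain : Set H)) (h : ∀ x, ∃ a : A.domain, (a : H) + A a = x) :
    IsSelfAdjoint A := by
  rw [isSelfAdjoint_def]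
  refine (eq_of_le_of_domain_eq (hA.le_adjoint hd) (le_antisymm (hA.le_adjoint hd).1 ?_)).symm
  intro x hx
  obtain ⟨a, ha⟩ := h (x + A.adjoint ⟨x, hx⟩)
  obtain ⟨b, hb⟩ := h (x - a)
  suffices x - a = 0 by rw [sub_eq_zero.1 this]; exact a.2
  rw [← inner_self_eq_zero (𝕜 := 𝕜)]
  nth_rw 2 [← hb]
  have h1 := adjoint_isFormalAdjoint hd ⟨x, hx⟩ b
  have h2 := hA.1 a b
  rw [inner_add_right, inner_sub_left, inner_sub_left, ← h1, ← h2, sub_add_sub_comm,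
    ← inner_add_left, ← inner_add_left, ← ha, sub_self]

theorem IsPositive.isEssentiallySelfAdjoint_of_adjoint (hA : A.IsPositive)
    (hd : Dense (A.domain : Set H)) (h : IsSelfAdjoint A.adjoint) :
    A.IsEssentiallySelfAdjoint := by
  have hd' := hA.dense_adjoint_domain hd
  refine ⟨isClosable_of_dense_adjoint_domain hd hd', ?_⟩
  rw [← adjoint_adjoint_eq_closure hd hd', isSelfAdjoint_def.1 h]
  exact h

/-- The adjoint of a positive operator whose closure is self-adjoint has no eigenvalue `-1`. -/
theorem IsPositive.not_isEssentiallySelfAdjoint (hA : A.IsPositive) {v : H} (hv : v ≠ 0)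
    (h : ∀ x : A.domain, inner 𝕜 v (x + A x) = 0) : ¬ A.IsEssentiallySelfAdjoint := by
  rintro ⟨hc, hs⟩
  -- Closed conditions on the graph pass to the closure; this is applied to orthogonality to `v` and
  -- to positivity.
  have hle (C : Set (H × H)) (hC : _root_.IsClosed C) (hAC : ∀ x : A.domain, ((x : H), A x) ∈ C)
      (x : A.closure.domain) : ((x : H), A.closure x) ∈ C := by
    refine closure_minimal (s := (A.graph : Set (H × H))) ?_ hC ?_
    · rintro ⟨a, b⟩ hab
      obtain ⟨x, rfl, rfl⟩ := (mem_graph_iff A).1 hab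
      exact hAC x
    · rw [← Submodule.topologicalClosure_coe, hc.graph_closure_eq_closure_graph]
      exact mem_graph _ x
  have h1 := hle {p | inner 𝕜 v (p.1 + p.2) = 0}
    (isClosed_eq (by fun_prop) continuous_const) h
  have h2 := hle {p | 0 ≤ RCLike.re (inner 𝕜 p.2 p.1)}
    (isClosed_le continuous_const (by fun_prop)) hA.2
  have key (x : A.closure.domain) : inner 𝕜 (-v) (x : H) = inner 𝕜 v (A.closure x) := by
    have := h1 x
    rw [Set.mem_ofPred_eq, inner_add_right] at this
    rw [inner_neg_left]
    exact (eq_neg_of_add_eq_zero_right this).symm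
  have hmem : v ∈ A.closure.adjoint.domain := mem_adjoint_domain_of_exists _ ⟨_, key⟩
  have hval : A.closure.adjoint ⟨v, hmem⟩ = -v := adjoint_apply_eq hs.dense_domain _ key
  -- Self-adjointness turns `Ā*v = -v` into `Āv = -v`, and positivity then gives `-‖v‖² ≥ 0`.
  have hg : (v, -v) ∈ A.closure.adjoint.graph := (mem_graph_iff _).2 ⟨⟨v, hmem⟩, rfl, hval⟩
  rw [isSelfAdjoint_def.1 hs] at hg
  obtain ⟨w, hw, hw'⟩ := (mem_graph_iff _).1 hg
  have h3 := h2 w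
  dsimp only at hw hw'
  rw [hw, hw', Set.mem_ofPred_eq] at h3
  dsimp only at h3
  rw [inner_neg_left, _root_.map_neg, Left.nonneg_neg_iff] at h3
  exact hv ((re_inner_self_nonpos (𝕜 := 𝕜)).1 h3)

end Positive

/-! ### The factorization of `A` through `H_A`. -/

section RanEmbedding

variable {𝕜 H : Type*} [RCLike 𝕜] [NormedAddCommGroup H] [InnerProductSpace 𝕜 H]
  {A : H →ₗ.[𝕜] H} (hd : Dense (A.domain : Set H)) (hA : A.IsPositive)

theorem dense_ranEmbedding_domain :
    Dense ((A.ranEmbedding hd hA).domain : Set (A.EnergySpace hd hA)) :=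
  UniformSpace.Completion.denseRange_coe

theorem exists_eq_mk_of_ranEmbedding_domain (u : (A.ranEmbedding hd hA).domain) :
    ∃ y : A.domain, (u : A.EnergySpace hd hA) = A.toEnergySpace hd hA (RanSpace.mk A hd hA y) ∧
      A.ranEmbedding hd hA u = A y := by
  obtain ⟨_, w, rfl⟩ := u
  obtain ⟨y, rfl⟩ := RanSpace.mk_surjective w
  exact ⟨y, rfl, ranEmbedding_apply A hd hA _⟩

theorem inner_toEnergySpace_mk (x : A.domain) (u : (A.ranEmbedding hd hA).domain) :
    inner 𝕜 (A.toEnergySpace hd hA (RanSpace.mk A hd hA x)) (u : A.EnergySpace hd hA) =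
      inner 𝕜 (x : H) (A.ranEmbedding hd hA u) := by
  obtain ⟨y, hy, hy'⟩ := exists_eq_mk_of_ranEmbedding_domain hd hA u
  rw [hy, hy', LinearIsometry.inner_map_map, RanSpace.inner_mk_mk, hA.1]

theorem domain_le_adjoint_ranEmbedding_domain :
    A.domain ≤ (A.ranEmbedding hd hA).adjoint.domain := fun x hx =>
  mem_adjoint_domain_of_exists _ ⟨_, inner_toEnergySpace_mk hd hA ⟨x, hx⟩⟩

theorem adjoint_ranEmbedding_apply (x : A.domain)
    (hx : (x : H) ∈ (A.ranEmbedding hd hA).adjoint.domain) :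
    (A.ranEmbedding hd hA).adjoint ⟨x, hx⟩ = A.toEnergySpace hd hA (RanSpace.mk A hd hA x) :=
  adjoint_apply_eq (dense_ranEmbedding_domain hd hA) _ (inner_toEnergySpace_mk hd hA x)

theorem dense_adjoint_ranEmbedding_domain :
    Dense ((A.ranEmbedding hd hA).adjoint.domain : Set H) :=
  hd.mono (domain_le_adjoint_ranEmbedding_domain hd hA)

/-- Stated for any extension `S` of `T`, to serve both `S = T` and `S = T̄`. -/
theorem le_prodOp_adjoint_ranEmbedding {S : A.EnergySpace hd hA →ₗ.[𝕜] H}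
    (hS : A.ranEmbedding hd hA ≤ S) : A ≤ S.prodOp (A.ranEmbedding hd hA).adjoint := by
  have hmem (x : A.domain) : (A.ranEmbedding hd hA).adjoint
      ⟨x, domain_le_adjoint_ranEmbedding_domain hd hA x.2⟩ ∈ (A.ranEmbedding hd hA).domain := by
    rw [adjoint_ranEmbedding_apply]
    exact mem_ranEmbedding_domain A hd hA _
  have hdom : A.domain ≤ (S.prodOp (A.ranEmbedding hd hA).adjoint).domain := fun x hx =>
    ⟨domain_le_adjoint_ranEmbedding_domain hd hA hx, hS.1 (hmem ⟨x, hx⟩)⟩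
  refine ⟨hdom, ?_⟩
  rintro x ⟨_, hy⟩ rfl
  rw [prodOp_apply _ (domain_le_adjoint_ranEmbedding_domain hd hA x.2) (hS.1 (hmem x)),
    ← hS.2 (x := ⟨_, hmem x⟩) rfl, ← RanSpace.toH_mk (hd := hd) (hA := hA),
    ← ranEmbedding_apply]
  congr 1
  exact Subtype.ext (adjoint_ranEmbedding_apply hd hA x _).symm

/-- The kernel of `T*` is orthogonal to `ran T = ran A`. -/
theorem adjoint_ranEmbedding_injective (hr : Dense (Set.range A)) :
    Function.Injective (A.ranEmbedding hd hA).adjoint := by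
  refine (injective_iff_map_eq_zero (A.ranEmbedding hd hA).adjoint.toFun).2 fun x hx => ?_
  refine Subtype.ext (hr.eq_zero_of_inner_left 𝕜 ?_)
  rintro _ ⟨y, rfl⟩
  have hT := mem_ranEmbedding_domain A hd hA (RanSpace.mk A hd hA y)
  have h := adjoint_isFormalAdjoint (dense_ranEmbedding_domain hd hA) x ⟨_, hT⟩
  rw [ranEmbedding_apply, RanSpace.toH_mk] at h
  rw [← h]
  exact (congrArg (inner 𝕜 · _) hx).trans (inner_zero_left _)

theorem ranEmbedding_prodOp_adjoint (hr : Dense (Set.range A)) :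
    (A.ranEmbedding hd hA).prodOp (A.ranEmbedding hd hA).adjoint = A := by
  have hle := le_prodOp_adjoint_ranEmbedding hd hA le_rfl
  refine (eq_of_le_of_domain_eq hle (le_antisymm hle.1 ?_)).symm
  rintro x ⟨hx, hx'⟩
  obtain ⟨y, hy, -⟩ := exists_eq_mk_of_ranEmbedding_domain hd hA ⟨_, hx'⟩
  rw [← adjoint_ranEmbedding_apply hd hA y (domain_le_adjoint_ranEmbedding_domain hd hA y.2)] at hy
  have hxy : x = y := congrArg Subtype.val (adjoint_ranEmbedding_injective hd hA hr hy)
  rw [hxy]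
  exact y.2

theorem isSelfAdjoint_closure_ranEmbedding_prodOp_adjoint [CompleteSpace H] :
    IsSelfAdjoint ((A.ranEmbedding hd hA).closure.prodOp (A.ranEmbedding hd hA).adjoint) ∧
      ((A.ranEmbedding hd hA).closure.prodOp (A.ranEmbedding hd hA).adjoint).IsPositive := by
  have hT := dense_ranEmbedding_domain hd hA
  have hT' := dense_adjoint_ranEmbedding_domain hd hA
  have hle := le_prodOp_adjoint_ranEmbedding hd hA (le_closure _)
  -- With `T̄ = T**` the product becomes `S*S` for the closed, densely defined `S = T*`.
  rw [← adjoint_adjoint_eq_closure hT hT'] at hle ⊢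
  have hpos := isPositive_adjoint_prodOp hT'
  exact ⟨hpos.isSelfAdjoint_of_one_add_surjective (hd.mono hle.1)
    ((adjoint_isClosed hT).exists_add_prodOp_adjoint_eq hT'), hpos⟩

end RanEmbedding

/-! ### Positive operators that are not essentially self-adjoint. -/

section RestrictedInverse

variable {𝕜 H : Type*} [RCLike 𝕜] [NormedAddCommGroup H] [InnerProductSpace 𝕜 H]
  [CompleteSpace H]

/-- If `z` is orthogonal to `B(v^⊥)`, then `Bz ∈ v^⊥⊥` is a multiple of `v`; as `v ∉ ran B`, it is
zero. -/
theorem _root_.LinearMap.IsSymmetric.dense_image_orthogonal {B : H →ₗ[𝕜] H} (hB : B.IsSymmetric)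
    (hi : Function.Injective B) {v : H} (hv : v ∉ LinearMap.range B) :
    Dense (((𝕜 ∙ v)ᗮ.map B : Submodule 𝕜 H) : Set H) := by
  rw [Submodule.dense_iff_topologicalClosure_eq_top, Submodule.topologicalClosure_eq_top_iff,
    Submodule.eq_bot_iff]
  intro z hz
  have h : B z ∈ (𝕜 ∙ v)ᗮᗮ := fun w hw => by
    rw [← hB]
    exact hz _ (Submodule.mem_map_of_mem hw)
  rw [Submodule.orthogonal_orthogonal, Submodule.mem_span_singleton] at h
  obtain ⟨c, hc⟩ := h
  rcases eq_or_ne c 0 with rfl | hc0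
  · exact hi (by rw [← hc, zero_smul, _root_.map_zero])
  · exact (hv ⟨c⁻¹ • z, by rw [_root_.map_smul, ← hc, inv_smul_smul₀ hc0]⟩).elim

/-- For a self-adjoint `R = (1 + S)⁻¹`, the restriction of `S` to `R v^⊥`. -/
noncomputable def restrictedInverse (R : H →ₗ[𝕜] H) (hi : Function.Injective R) (v : H) : H →ₗ.[𝕜] H where
  domain := (𝕜 ∙ v)ᗮ.map R
  toFun := ((1 - R).domRestrict (𝕜 ∙ v)ᗮ).comp
    (Submodule.equivMapOfInjective R hi (𝕜 ∙ v)ᗮ).symm.toLinearMap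

omit [CompleteSpace H] in
theorem restrictedInverse_apply {R : H →ₗ[𝕜] H} (hi : Function.Injective R) {v w : H}
    (hw : w ∈ (𝕜 ∙ v)ᗮ) :
    restrictedInverse R hi v ⟨R w, Submodule.mem_map_of_mem hw⟩ = w - R w := by
  have h : (Submodule.equivMapOfInjective R hi (𝕜 ∙ v)ᗮ).symm
      ⟨R w, Submodule.mem_map_of_mem hw⟩ = ⟨w, hw⟩ :=
    (LinearEquiv.symm_apply_eq _).2 rfl
  exact congrArg (fun u : (𝕜 ∙ v)ᗮ => (1 - R : H →ₗ[𝕜] H) u) h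

/-- With `A = R⁻¹ - 1` on `R(v^⊥)`, `hv` makes the domain dense and `hv'` the range `(1 - R)(v^⊥)`.
Each `x + Ax` equals some `w ∈ v^⊥`. -/
theorem exists_isPositive_not_isEssentiallySelfAdjoint {R : H →ₗ[𝕜] H} (hR : R.IsSymmetric)
    (hi : Function.Injective R) (hi' : Function.Injective (1 - R : H →ₗ[𝕜] H))
    (hpos : ∀ w, 0 ≤ RCLike.re (inner 𝕜 ((1 - R : H →ₗ[𝕜] H) w) (R w))) {v : H}
    (hv : v ∉ LinearMap.range R) (hv' : v ∉ LinearMap.range (1 - R : H →ₗ[𝕜] H)) :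
    ∃ (A : H →ₗ.[𝕜] H) (_ : Dense (A.domain : Set H)) (_ : A.IsPositive),
      ¬ A.IsEssentiallySelfAdjoint ∧ Dense (Set.range A) := by
  let A := restrictedInverse R hi v
  have hd : Dense (A.domain : Set H) := hR.dense_image_orthogonal hi hv
  have hex (x : A.domain) : ∃ w ∈ (𝕜 ∙ v)ᗮ, (x : H) = R w ∧ A x = w - R w := by
    obtain ⟨_, w, hw, rfl⟩ := x
    exact ⟨w, hw, rfl, restrictedInverse_apply hi hw⟩
  have hA : A.IsPositive := by
    constructor
    · intro x y
      obtain ⟨a, -, ha, ha'⟩ := hex x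
      obtain ⟨b, -, hb, hb'⟩ := hex y
      rw [ha, ha', hb, hb', inner_sub_left, inner_sub_right, hR a b]
    · intro x
      obtain ⟨a, -, ha, ha'⟩ := hex x
      rw [ha, ha']
      exact hpos a
  refine ⟨A, hd, hA, hA.not_isEssentiallySelfAdjoint (v := v) ?_ ?_, ?_⟩
  · rintro rfl
    exact hv (zero_mem _)
  · intro x
    obtain ⟨a, hav, ha, ha'⟩ := hex x
    rw [ha, ha', add_sub_cancel]
    exact Submodule.mem_orthogonal_singleton_iff_inner_right.1 hav
  · refine (LinearMap.IsSymmetric.dense_image_orthogonal (LinearMap.IsSymmetric.id.sub hR)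
      hi' hv').mono ?_
    rintro _ ⟨w, hw, rfl⟩
    exact ⟨_, restrictedInverse_apply hi hw⟩

end RestrictedInverse

end LinearPMap

/-! ### A diagonal example on `ℓ²`. -/

section Diagonal

variable {𝕜 : Type*} [RCLike 𝕜] {d : ℕ → ℝ}

/-- The diagonal operator on `ℓ²` with entries in `[-1, 1]`. -/
noncomputable def lpDiagonal (𝕜 : Type*) [RCLike 𝕜] {d : ℕ → ℝ} (hd : ∀ n, |d n| ≤ 1) :
    lp (fun _ : ℕ => 𝕜) 2 →ₗ[𝕜] lp (fun _ : ℕ => 𝕜) 2 where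
  toFun f := ⟨fun n => (d n : 𝕜) * f n, (lp.memℓp f).mono' fun n => by
    rw [norm_mul, RCLike.norm_ofReal]
    exact mul_le_of_le_one_left (norm_nonneg _) (hd n)⟩
  map_add' f g := lp.ext <| funext fun n => mul_add _ _ _
  map_smul' c f := lp.ext <| funext fun n => mul_left_comm _ _ _

theorem lpDiagonal_apply (hd : ∀ n, |d n| ≤ 1) (f : lp (fun _ : ℕ => 𝕜) 2) (n : ℕ) :
    lpDiagonal 𝕜 hd f n = d n * f n := rfl

theorem lpDiagonal_isSymmetric (hd : ∀ n, |d n| ≤ 1) : (lpDiagonal 𝕜 hd).IsSymmetric := by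
  intro f g
  rw [lp.inner_eq_tsum, lp.inner_eq_tsum]
  refine tsum_congr fun n => ?_
  simp only [lpDiagonal_apply, RCLike.inner_apply, map_mul, RCLike.conj_ofReal]
  ring

theorem lpDiagonal_injective (hd : ∀ n, |d n| ≤ 1) (h0 : ∀ n, d n ≠ 0) :
    Function.Injective (lpDiagonal 𝕜 hd) := by
  intro f g hfg
  refine lp.ext (funext fun n => ?_)
  have h := congrFun (congrArg (fun x : lp (fun _ : ℕ => 𝕜) 2 => (x : ℕ → 𝕜)) hfg) n
  exact mul_left_cancel₀ (RCLike.ofReal_ne_zero.2 (h0 n)) h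

theorem one_sub_lpDiagonal (hd : ∀ n, |d n| ≤ 1) (hd' : ∀ n, |1 - d n| ≤ 1) :
    1 - lpDiagonal 𝕜 hd = lpDiagonal 𝕜 hd' := by
  refine LinearMap.ext fun f => lp.ext (funext fun n => ?_)
  change f n - (d n : 𝕜) * f n = ((1 - d n : ℝ) : 𝕜) * f n
  push_cast
  ring

theorem re_inner_lpDiagonal_nonneg {e : ℕ → ℝ} (hd : ∀ n, |d n| ≤ 1) (he : ∀ n, |e n| ≤ 1)
    (hde : ∀ n, 0 ≤ d n * e n) (f : lp (fun _ : ℕ => 𝕜) 2) :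
    0 ≤ RCLike.re (inner 𝕜 (lpDiagonal 𝕜 hd f) (lpDiagonal 𝕜 he f)) := by
  have h := (lp.hasSum_inner (𝕜 := 𝕜) (lpDiagonal 𝕜 hd f) (lpDiagonal 𝕜 he f)).mapL RCLike.reCLM
  refine h.nonneg fun n => ?_
  have hn : (inner 𝕜 (lpDiagonal 𝕜 hd f n) (lpDiagonal 𝕜 he f n) : 𝕜) =
      ((d n * e n * ‖f n‖ ^ 2 : ℝ) : 𝕜) := by
    rw [lpDiagonal_apply, lpDiagonal_apply, RCLike.inner_apply, map_mul, RCLike.conj_ofReal]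
    push_cast
    rw [← RCLike.mul_conj]
    ring
  rw [hn, RCLike.reCLM_apply, RCLike.ofReal_re]
  exact mul_nonneg (hde n) (sq_nonneg _)

/-- A preimage of `v` would have infinitely many entries equal to `1`, which square summability
excludes. -/
theorem notMem_range_lpDiagonal (hd : ∀ n, |d n| ≤ 1) (v : lp (fun _ : ℕ => 𝕜) 2)
    (h : ∃ᶠ n in Filter.atTop, v n ≠ 0 ∧ v n = d n) :
    v ∉ LinearMap.range (lpDiagonal 𝕜 hd) := by
  rintro ⟨w, rfl⟩
  have hs := (lp.memℓp w).summable (by norm_num)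
  refine h (((hs.tendsto_atTop_zero).eventually_lt_const zero_lt_one).mono fun n hn hn' => ?_)
  dsimp only at hn'
  rw [lpDiagonal_apply] at hn'
  have h1 : w n = 1 := (mul_eq_left₀ (left_ne_zero_of_mul hn'.1)).1 hn'.2
  simp [h1] at hn

theorem exists_lp_isPositive_not_isEssentiallySelfAdjoint (𝕜 : Type*) [RCLike 𝕜] :
    ∃ (A : lp (fun _ : ℕ => 𝕜) 2 →ₗ.[𝕜] lp (fun _ : ℕ => 𝕜) 2)
      (_ : Dense (A.domain : Set (lp (fun _ : ℕ => 𝕜) 2))) (_ : A.IsPositive),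
      ¬ A.IsEssentiallySelfAdjoint ∧ Dense (Set.range A) := by
  -- The shift by `2` keeps `t n < 1`, so that `1 - d n` never vanishes.
  let t (n : ℕ) : ℝ := 1 / (n + 2)
  have ht0 (n : ℕ) : 0 < t n := by positivity
  have ht1 (n : ℕ) : t n < 1 := by
    rw [div_lt_one (by positivity)]
    linarith [n.cast_nonneg (α := ℝ)]
  -- The square-summable `v = t` agrees with `d` at even indices and with `1 - d` at odd ones, so it
  -- escapes both ranges.
  let d (n : ℕ) : ℝ := if Even n then t n else 1 - t n
  have hd0 (n : ℕ) : 0 < d n := by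
    dsimp only [d]; split_ifs <;> linarith [ht0 n, ht1 n]
  have hd1 (n : ℕ) : 0 < 1 - d n := by
    dsimp only [d]; split_ifs <;> linarith [ht0 n, ht1 n]
  have hd (n : ℕ) : |d n| ≤ 1 := abs_le.2 ⟨by linarith [hd0 n], by linarith [hd1 n]⟩
  have hd' (n : ℕ) : |1 - d n| ≤ 1 := abs_le.2 ⟨by linarith [hd1 n], by linarith [hd0 n]⟩
  have hmem : Memℓp (fun n => (t n : 𝕜)) 2 := by
    refine memℓp_gen ?_
    have h := (summable_nat_add_iff 2).2 (Real.summable_one_div_nat_pow.2 one_lt_two)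
    refine h.congr fun n => ?_
    rw [RCLike.norm_ofReal, abs_of_pos (ht0 n)]
    simp [t]
  let v : lp (fun _ : ℕ => 𝕜) 2 := ⟨_, hmem⟩
  have hv0 (n : ℕ) : v n ≠ 0 := RCLike.ofReal_ne_zero.2 (ht0 n).ne'
  have hsub := one_sub_lpDiagonal (𝕜 := 𝕜) hd hd'
  refine LinearPMap.exists_isPositive_not_isEssentiallySelfAdjoint (lpDiagonal_isSymmetric hd)
    (lpDiagonal_injective hd fun n => (hd0 n).ne') ?_ ?_ (v := v) ?_ ?_
  · rw [hsub]
    exact lpDiagonal_injective hd' fun n => (hd1 n).ne'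
  · rw [hsub]
    exact re_inner_lpDiagonal_nonneg hd' hd fun n => (mul_pos (hd1 n) (hd0 n)).le
  · refine notMem_range_lpDiagonal hd v (Filter.frequently_atTop.2 fun n => ?_)
    refine ⟨2 * n, by omega, hv0 _, ?_⟩
    change (t (2 * n) : 𝕜) = (d (2 * n) : 𝕜)
    simp [d]
  · rw [hsub]
    refine notMem_range_lpDiagonal hd' v (Filter.frequently_atTop.2 fun n => ?_)
    refine ⟨2 * n + 1, by omega, hv0 _, ?_⟩
    change (t (2 * n + 1) : 𝕜) = ((1 - d (2 * n + 1) : ℝ) : 𝕜)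
    simp [d]

end Diagonal

theorem LinearPMap.ranEmbedding_properties {𝕜 : Type u} {H : Type v} [RCLike 𝕜]
    [NormedAddCommGroup H] [InnerProductSpace 𝕜 H] [CompleteSpace H]
    (A : H →ₗ.[𝕜] H) (hd : Dense (A.domain : Set H)) (hA : A.IsPositive)
    (hne : ¬ A.IsEssentiallySelfAdjoint) (hr : Dense (Set.range A))
    (T : A.EnergySpace hd hA →ₗ.[𝕜] H) (hTA : T = A.ranEmbedding hd hA) :
    Dense (T.domain : Set (A.EnergySpace hd hA)) ∧
        T.IsClosable ∧
        -- `D(A) ⊆ D(T*)` and `T* x = A x ∈ H_A` for `x ∈ D(A)`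
        (∀ x : A.domain, ∃ hx : (x : H) ∈ T.adjoint.domain,
          T.adjoint ⟨x, hx⟩ = A.toEnergySpace hd hA (LinearPMap.RanSpace.mk A hd hA x)) ∧
        -- `T**` is the closure of `T`, and `T** T*` is a self-adjoint positive extension of `A`
        T.adjoint.adjoint = T.closure ∧
        IsSelfAdjoint (T.closure.prodOp T.adjoint) ∧
        (T.closure.prodOp T.adjoint).IsPositive ∧
        A ≤ T.closure.prodOp T.adjoint ∧
        -- `T*` is one-to-one
        Function.Injective T.adjoint ∧
        T.prodOp T.adjoint = A ∧
        -- `(T T*)* = A*` is not self-adjoint and differs from `T** T*` and from `T T*`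
        (T.prodOp T.adjoint).adjoint = A.adjoint ∧
        ¬ IsSelfAdjoint (T.prodOp T.adjoint).adjoint ∧
        (T.prodOp T.adjoint).adjoint ≠ T.closure.prodOp T.adjoint ∧
        (T.prodOp T.adjoint).adjoint ≠ T.prodOp T.adjoint := by
  subst hTA
  have hT := dense_ranEmbedding_domain hd hA
  have hT' := dense_adjoint_ranEmbedding_domain hd hA
  obtain ⟨hs, hp⟩ := isSelfAdjoint_closure_ranEmbedding_prodOp_adjoint hd hA
  have hnot : ¬ IsSelfAdjoint A.adjoint := fun h =>
    hne (hA.isEssentiallySelfAdjoint_of_adjoint hd h)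
  rw [ranEmbedding_prodOp_adjoint hd hA hr]
  refine ⟨hT, isClosable_of_dense_adjoint_domain hT hT',
    fun x => ⟨domain_le_adjoint_ranEmbedding_domain hd hA x.2,
      adjoint_ranEmbedding_apply hd hA x _⟩,
    adjoint_adjoint_eq_closure hT hT', hs, hp,
    le_prodOp_adjoint_ranEmbedding hd hA (le_closure _),
    adjoint_ranEmbedding_injective hd hA hr, rfl, rfl, hnot, fun h => hnot (h ▸ hs), fun h => ?_⟩
  have hsA : IsSelfAdjoint A := isSelfAdjoint_def.2 h
  exact hnot (h.symm ▸ hsA)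

theorem mainTheorem3 {𝕜 : Type u} [RCLike 𝕜] :
    -- there are an operator `A` as below and a `T` built from it with `(T T*)* ≠ (closure T) T*`
    (∃ (H : Type u) (_ : NormedAddCommGroup H) (_ : InnerProductSpace 𝕜 H) (_ : CompleteSpace H)
      (A : H →ₗ.[𝕜] H) (hd : Dense (A.domain : Set H)) (hA : A.IsPositive),
      ¬ A.IsEssentiallySelfAdjoint ∧
      Dense (Set.range A) ∧
      Dense ((A.ranEmbedding hd hA).domain : Set (A.EnergySpace hd hA)) ∧
      (A.ranEmbedding hd hA).IsClosable ∧
      ((A.ranEmbedding hd hA).prodOp (A.ranEmbedding hd hA).adjoint).adjoint ≠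
        (A.ranEmbedding hd hA).closure.prodOp (A.ranEmbedding hd hA).adjoint) ∧
    -- the construction, for every `A`
    (∀ {H : Type v} [NormedAddCommGroup H] [InnerProductSpace 𝕜 H] [CompleteSpace H]
      (A : H →ₗ.[𝕜] H) (hd : Dense (A.domain : Set H)) (hA : A.IsPositive),
      ¬ A.IsEssentiallySelfAdjoint →
      Dense (Set.range A) →
      ∀ T : A.EnergySpace hd hA →ₗ.[𝕜] H, T = A.ranEmbedding hd hA →
        Dense (T.domain : Set (A.EnergySpace hd hA)) ∧
        T.IsClosable ∧
        -- `D(A) ⊆ D(T*)` and `T* x = A x ∈ H_A` for `x ∈ D(A)`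
        (∀ x : A.domain, ∃ hx : (x : H) ∈ T.adjoint.domain,
          T.adjoint ⟨x, hx⟩ = A.toEnergySpace hd hA (LinearPMap.RanSpace.mk A hd hA x)) ∧
        -- `T**` is the closure of `T`, and `T** T*` is a self-adjoint positive extension of `A`
        T.adjoint.adjoint = T.closure ∧
        IsSelfAdjoint (T.closure.prodOp T.adjoint) ∧
        (T.closure.prodOp T.adjoint).IsPositive ∧
        A ≤ T.closure.prodOp T.adjoint ∧
        -- `T*` is one-to-one
        Function.Injective T.adjoint ∧
        T.prodOp T.adjoint = A ∧
        -- `(T T*)* = A*` is not self-adjoint and differs from `T** T*` and from `T T*`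
        (T.prodOp T.adjoint).adjoint = A.adjoint ∧
        ¬ IsSelfAdjoint (T.prodOp T.adjoint).adjoint ∧
        (T.prodOp T.adjoint).adjoint ≠ T.closure.prodOp T.adjoint ∧
        (T.prodOp T.adjoint).adjoint ≠ T.prodOp T.adjoint) := by
  refine ⟨?_, fun A hd hA hne hr T hT => A.ranEmbedding_properties hd hA hne hr T hT⟩
  obtain ⟨A, hd, hA, hne, hr⟩ := exists_lp_isPositive_not_isEssentiallySelfAdjoint 𝕜
  obtain ⟨hT, hc, -, -, -, -, -, -, -, -, -, hn, -⟩ :=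
    A.ranEmbedding_properties hd hA hne hr _ rfl
  exact ⟨_, inferInstance, inferInstance, inferInstance, A, hd, hA, hne, hr, hT, hc, hn⟩
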